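/- For a group $H$ and an integer $k\ge 0$, the Andrews–Curtis graph $\Delta_k(H,H)$ is the graph whose vertices are the $k$-tuples $(h_1,\dots,h_k)\in H^k$ whose normal closure in $H$ is $H$. Two distinct vertices are joined by an edge if one is obtained from the other by one of the following moves, each of which changes a single entry $x_i$: $x_i\mapsto x_ix_j^{\pm1}$ with $j\ne i$; $x_i\mapsto x_j^{\pm1}x_i$ with $j\neq i$; $x_i\mapsto x_i^{-1}$; $x_i\mapsto w^{-1}x_iw$ with $w\in H$. Let $G$ be a finite nilpotent group and let $k\ge 0$. The quotient homomorphism $G\to G/[G,G]$, applied to each entry, induces a map from the vertices of $\Delta_k(G,G)$ to the vertices of $\Delta_k(G/[G,G],\,G/[G,G])$. Then for every connected component $C$ of $\Delta_k(G/[G,G],\,G/[G,G])$, the preimage of $C$ under this map is non-empty and induces a connected subgraph of $\Delta_k(G,G)$. -/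

import Mathlib

namespace AndrewsCurtis

/-- `V_k(G, N)`: the `k`-tuples of elements whose normal closure in `G` is `N`
(in particular all entries lie in `N`). -/
def Vertex (k : ℕ) (G : Type*) [Group G] (N : Subgroup G) : Type _ :=
  {h : Fin k → G // Subgroup.normalClosure (Set.range h) = N}

/-- `Move x y`: the tuple `y` is obtained from `x` by an elementary
Andrews-Curtis transformation. -/
inductive Move {k : ℕ} {G : Type*} [Group G] : (Fin k → G) → (Fin k → G) → Prop
  | mul_right (x : Fin k → G) (i j : Fin k) (hij : i ≠ j) :
      Move x (Function.update x i (x i * x j))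
  | mul_right_inv (x : Fin k → G) (i j : Fin k) (hij : i ≠ j) :
      Move x (Function.update x i (x i * (x j)⁻¹))
  | mul_left (x : Fin k → G) (i j : Fin k) (hij : i ≠ j) :
      Move x (Function.update x i (x j * x i))
  | mul_left_inv (x : Fin k → G) (i j : Fin k) (hij : i ≠ j) :
      Move x (Function.update x i ((x j)⁻¹ * x i))
  | inv (x : Fin k → G) (i : Fin k) :
      Move x (Function.update x i (x i)⁻¹)
  | conj (x : Fin k → G) (i : Fin k) (w : G) :
      Move x (Function.update x i (w⁻¹ * x i * w))

/-- The Andrews-Curtis graph `Δ_k(G, N)`: two distinct vertices are joined by an edge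
if one of them is obtained from the other by an elementary transformation. -/
def graph (k : ℕ) (G : Type*) [Group G] (N : Subgroup G) : SimpleGraph (Vertex k G N) :=
  SimpleGraph.fromRel fun x y => Move x.1 y.1

theorem normalClosure_range_comp {k : ℕ} {G H : Type*} [Group G] [Group H] (φ : G →* H)
    (hφ : Function.Surjective φ) (x : Fin k → G)
    (hx : Subgroup.normalClosure (Set.range x) = ⊤) :
    Subgroup.normalClosure (Set.range fun i => φ (x i)) = ⊤ := by
  have h := Subgroup.map_normalClosure (Set.range x) φ hφ
  rw [hx, Subgroup.map_top_of_surjective φ hφ, ← Set.range_comp] at h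
  exact h.symm

/-- The map on vertices `Δ_k(G, G) → Δ_k(H, H)` induced by an epimorphism `φ : G → H`,
applying `φ` to each entry of a tuple. -/
def vertexMap (k : ℕ) {G H : Type*} [Group G] [Group H] (φ : G →* H)
    (hφ : Function.Surjective φ) (x : Vertex k G ⊤) : Vertex k H ⊤ :=
  ⟨fun i => φ (x.1 i), normalClosure_range_comp φ hφ x.1 x.2⟩

end AndrewsCurtis

namespace AndrewsCurtis

open Relation Function
open scoped commutatorElement

/-! ### Elementary transformations: invertibility, invariance of the normal closure, lifting. -/

section Moves

variable {k : ℕ} {G H : Type*} [Group G] [Group H]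

/-! Moves lift along epimorphisms, so a path in the abelianization lifts to `G`, and it remains to
join tuples that agree entrywise modulo `[G,G]`. Induct on the nilpotency class: modulo the last
nontrivial term `[N,G]` of the lower central series they are joined, and lifting that path leaves an
error in `[N,G]`, which is central and generated by commutators `⁅g, h⁆` with `g ∈ N`. For fixed `g`
this is a homomorphism in `h` to the centre, so it suffices to multiply an entry by `⁅g, x j⁆`,
which a few moves achieve (`commutator_entry_mem_centralMultipliers`). Fibres are non-empty because
a tuple normally generating a nilpotent group modulo `[G,G]` normally generates it. -/

theorem Move.symm {x y : Fin k → G} (h : Move x y) : Move y x := by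
  cases h with
  | mul_right i j hij =>
    simpa [hij.symm] using Move.mul_right_inv (update x i (x i * x j)) i j hij
  | mul_right_inv i j hij =>
    simpa [hij.symm] using Move.mul_right (update x i (x i * (x j)⁻¹)) i j hij
  | mul_left i j hij =>
    simpa [hij.symm] using Move.mul_left_inv (update x i (x j * x i)) i j hij
  | mul_left_inv i j hij =>
    simpa [hij.symm] using Move.mul_left (update x i ((x j)⁻¹ * x i)) i j hij
  | inv i => simpa using Move.inv (update x i (x i)⁻¹) i
  | conj i w =>
    simpa [mul_assoc] using Move.conj (update x i (w⁻¹ * x i * w)) i w⁻¹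

theorem reflTransGen_move_symm {x y : Fin k → G} (h : ReflTransGen Move x y) :
    ReflTransGen Move y x :=
  have : Std.Symm (Move (k := k) (G := G)) := ⟨fun _ _ => Move.symm⟩
  ReflTransGen.stdSymm.symm _ _ h

theorem Move.normalClosure_le {x y : Fin k → G} (h : Move x y) :
    Subgroup.normalClosure (Set.range y) ≤ Subgroup.normalClosure (Set.range x) := by
  have mem (j : Fin k) : x j ∈ Subgroup.normalClosure (Set.range x) :=
    Subgroup.subset_normalClosure ⟨j, rfl⟩
  have key (i : Fin k) (v : G) (hv : v ∈ Subgroup.normalClosure (Set.range x)) :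
      Subgroup.normalClosure (Set.range (update x i v)) ≤
        Subgroup.normalClosure (Set.range x) := by
    refine Subgroup.normalClosure_le_normal ?_
    rintro _ ⟨j, rfl⟩
    by_cases hj : j = i
    · subst hj
      simpa using hv
    · simpa [hj] using mem j
  cases h with
  | mul_right i j hij => exact key _ _ (mul_mem (mem i) (mem j))
  | mul_right_inv i j hij => exact key _ _ (mul_mem (mem i) (inv_mem (mem j)))
  | mul_left i j hij => exact key _ _ (mul_mem (mem j) (mem i))
  | mul_left_inv i j hij => exact key _ _ (mul_mem (inv_mem (mem j)) (mem i))
  | inv i => exact key _ _ (inv_mem (mem i))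
  | conj i w =>
    refine key _ _ ?_
    simpa using Subgroup.normalClosure_normal.conj_mem _ (mem i) w⁻¹

theorem Move.normalClosure_eq {x y : Fin k → G} (h : Move x y) :
    Subgroup.normalClosure (Set.range y) = Subgroup.normalClosure (Set.range x) :=
  le_antisymm h.normalClosure_le h.symm.normalClosure_le

theorem normalClosure_eq_of_reflTransGen {x y : Fin k → G} (h : ReflTransGen Move x y) :
    Subgroup.normalClosure (Set.range y) = Subgroup.normalClosure (Set.range x) := by
  induction h with
  | refl => rfl
  | tail _ h ih => rw [h.normalClosure_eq, ih]

theorem Move.map (φ : G →* H) {x y : Fin k → G} (h : Move x y) :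
    Move (fun i => φ (x i)) (fun i => φ (y i)) := by
  have key (i : Fin k) (v : G) :
      (fun j => φ (update x i v j)) = update (fun j => φ (x j)) i (φ v) := by
    funext j
    exact apply_update (fun _ => φ) x i v j
  cases h with
  | mul_right i j hij => simpa [key] using Move.mul_right (fun i => φ (x i)) i j hij
  | mul_right_inv i j hij => simpa [key] using Move.mul_right_inv (fun i => φ (x i)) i j hij
  | mul_left i j hij => simpa [key] using Move.mul_left (fun i => φ (x i)) i j hij
  | mul_left_inv i j hij => simpa [key] using Move.mul_left_inv (fun i => φ (x i)) i j hij
  | inv i => simpa [key] using Move.inv (fun i => φ (x i)) i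
  | conj i w => simpa [key] using Move.conj (fun i => φ (x i)) i (φ w)

/-- Elementary transformations lift along epimorphisms. -/
theorem Move.lift (φ : G →* H) (hφ : Surjective φ) (x : Fin k → G) {b : Fin k → H}
    (h : Move (fun i => φ (x i)) b) : ∃ y, Move x y ∧ (fun i => φ (y i)) = b := by
  have key (i : Fin k) (v : G) :
      (fun j => φ (update x i v j)) = update (fun j => φ (x j)) i (φ v) := by
    funext j
    exact apply_update (fun _ => φ) x i v j
  cases h with
  | mul_right i j hij => exact ⟨_, Move.mul_right x i j hij, by simp [key]⟩
  | mul_right_inv i j hij => exact ⟨_, Move.mul_right_inv x i j hij, by simp [key]⟩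
  | mul_left i j hij => exact ⟨_, Move.mul_left x i j hij, by simp [key]⟩
  | mul_left_inv i j hij => exact ⟨_, Move.mul_left_inv x i j hij, by simp [key]⟩
  | inv i => exact ⟨_, Move.inv x i, by simp [key]⟩
  | conj i w =>
    obtain ⟨w, rfl⟩ := hφ w
    exact ⟨_, Move.conj x i w, by simp [key]⟩

theorem reflTransGen_move_lift (φ : G →* H) (hφ : Surjective φ) (x : Fin k → G)
    {b : Fin k → H} (h : ReflTransGen Move (fun i => φ (x i)) b) :
    ∃ y, ReflTransGen Move x y ∧ (fun i => φ (y i)) = b := by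
  induction h with
  | refl => exact ⟨x, .refl, rfl⟩
  | tail _ h ih =>
    obtain ⟨y, hxy, rfl⟩ := ih
    obtain ⟨z, hyz, hz⟩ := h.lift φ hφ y
    exact ⟨z, hxy.tail hyz, hz⟩

end Moves

/-! ### Multiplying entries by central commutators. -/

section Central

variable {k : ℕ} {G : Type*} [Group G]

/-- The central elements by which the `i`-th entry of `x`, and of every tuple which differs from
`x` by a central factor in that entry, can be multiplied using elementary transformations. -/
def centralMultipliers (x : Fin k → G) (i : Fin k) : Subgroup G where
  carrier := {c | c ∈ Subgroup.center G ∧ ∀ d ∈ Subgroup.center G,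
    ReflTransGen Move (update x i (x i * d)) (update x i (x i * d * c))}
  one_mem' := ⟨one_mem _, fun d _ => by rw [mul_one]⟩
  mul_mem' := by
    rintro a b ⟨ha, ha'⟩ ⟨hb, hb'⟩
    -- Quantifying over all central `d` lets `b` act on the entry already multiplied by `a`.
    refine ⟨mul_mem ha hb, fun d hd => (ha' d hd).trans ?_⟩
    simpa only [mul_assoc] using hb' (d * a) (mul_mem hd ha)
  inv_mem' := by
    rintro a ⟨ha, ha'⟩
    refine ⟨inv_mem ha, fun d hd => reflTransGen_move_symm ?_⟩
    simpa [mul_assoc] using ha' (d * a⁻¹) (mul_mem hd (inv_mem ha))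

theorem commutator_entry_mem_centralMultipliers (x : Fin k → G) (i j : Fin k) (g : G)
    (hg : ⁅g, x j⁆ ∈ Subgroup.center G) : ⁅g, x j⁆ ∈ centralMultipliers x i := by
  refine ⟨hg, fun d hd => ?_⟩
  have hc := Subgroup.mem_center_iff.mp hg
  have hd' := Subgroup.mem_center_iff.mp hd
  have hconj : g * x j * g⁻¹ = x j * ⁅g, x j⁆ := by
    rw [hc, commutatorElement_def]; group
  by_cases hij : i = j
  · subst hij
    have h := Move.conj (update x i (x i * d)) i g⁻¹
    have e : g * (x i * d) * g⁻¹ = x i * d * ⁅g, x i⁆ := by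
      calc g * (x i * d) * g⁻¹ = g * x i * (d * g⁻¹) := by group
        _ = g * x i * g⁻¹ * d := by rw [← hd']; group
        _ = x i * d * ⁅g, x i⁆ := by rw [hconj, mul_assoc, hd', mul_assoc]
    simp only [update_self, update_idem, inv_inv, e] at h
    exact .single h
  · have hji : j ≠ i := Ne.symm hij
    -- Conjugate entry `j` to `g * x j * g⁻¹`, multiply it into entry `i`, conjugate back, then
    -- cancel with `(x j)⁻¹`: entry `i` gains `⁅g, x j⁆`.
    refine ((((ReflTransGen.refl.tail (Move.conj _ j g⁻¹)).tail
      (Move.mul_right _ i j hij)).tail (Move.conj _ j g)).tail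
      (Move.mul_right_inv _ i j hij)).trans (Eq.subst (motive := ReflTransGen Move _) ?_ .refl)
    funext l
    by_cases hl : l = i
    · subst hl
      simp only [update_self, update_of_ne hij, update_of_ne hji, inv_inv, commutatorElement_def]
      group
    · by_cases hl' : l = j
      · subst hl'
        simp [hl, hij]
        group
      · simp [hl, hl']

/-- The `h` that work form the preimage of a subgroup of the abelian group `center G` under `h ↦ ⁅g,
h⁆`. This preimage is normal and contains every `x j`, hence is everything. -/
theorem commutator_mem_centralMultipliers (x : Fin k → G)
    (hx : Subgroup.normalClosure (Set.range x) = ⊤) (i : Fin k) (g : G)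
    (hg : ∀ h, ⁅g, h⁆ ∈ Subgroup.center G) (h : G) : ⁅g, h⁆ ∈ centralMultipliers x i := by
  let f : G →* Subgroup.center G := MonoidHom.mk' (fun h => ⟨⁅g, h⁆, hg h⟩) fun a b => by
    ext
    have hb := Subgroup.mem_center_iff.mp (hg b) a
    calc ⁅g, a * b⁆ = ⁅g, a⁆ * (a * ⁅g, b⁆) * a⁻¹ := by simp only [commutatorElement_def]; group
      _ = ⁅g, a⁆ * ⁅g, b⁆ := by rw [hb]; group
  have hle : (⊤ : Subgroup G) ≤
      ((centralMultipliers x i).comap (Subgroup.center G).subtype).comap f := by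
    rw [← hx]
    refine Subgroup.normalClosure_le_normal ?_
    rintro _ ⟨j, rfl⟩
    exact commutator_entry_mem_centralMultipliers x i j g (hg _)
  exact hle (Subgroup.mem_top h)

theorem reflTransGen_move_of_central (N : Subgroup G) (hN : ⁅N, (⊤ : Subgroup G)⁆ ≤ .center G)
    (x y : Fin k → G) (hx : Subgroup.normalClosure (Set.range x) = ⊤)
    (hxy : ∀ i, (x i)⁻¹ * y i ∈ ⁅N, (⊤ : Subgroup G)⁆) : ReflTransGen Move x y := by
  have key (s : Finset (Fin k)) : ReflTransGen Move x (s.piecewise y x) := by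
    induction s using Finset.induction_on with
    | empty => simpa using ReflTransGen.refl
    | insert i s hi ih =>
      refine ih.trans ?_
      -- The current tuple still normally generates `G`, since moves preserve the normal closure.
      have hle : ⁅N, (⊤ : Subgroup G)⁆ ≤ centralMultipliers (s.piecewise y x) i :=
        Subgroup.commutator_le.mpr fun g hg h _ =>
          commutator_mem_centralMultipliers _
            ((normalClosure_eq_of_reflTransGen ih).trans hx) i g
            (fun a => hN (Subgroup.commutator_mem_commutator hg (Subgroup.mem_top a))) h
      have h := (hle (hxy i)).2 1 (one_mem _)
      rw [mul_one, update_eq_self] at h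
      simpa [hi, Finset.piecewise_insert] using h
  simpa using key Finset.univ

end Central

/-! ### Nilpotent groups: induction on the class, and lifting normal generation. -/

theorem reflTransGen_move_of_mem_commutator {k : ℕ} (n : ℕ) {G : Type*} [Group G]
    (hn : (⊤ : Subgroup G).lowerCentralSeries (n + 1) = ⊥) (x y : Fin k → G)
    (hx : Subgroup.normalClosure (Set.range x) = ⊤)
    (hxy : ∀ i, (x i)⁻¹ * y i ∈ commutator G) : ReflTransGen Move x y := by
  induction n generalizing G with
  | zero =>
    rw [zero_add, Subgroup.top_lowerCentralSeries_one] at hn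
    have : x = y := by
      funext i
      simpa [hn, inv_mul_eq_one] using hxy i
    rw [this]
  | succ n ih =>
    let N := (⊤ : Subgroup G).lowerCentralSeries (n + 1)
    let φ := QuotientGroup.mk' N
    have hφ : Surjective φ := QuotientGroup.mk'_surjective N
    have hQ : (⊤ : Subgroup (G ⧸ N)).lowerCentralSeries (n + 1) = ⊥ := by
      rw [← Subgroup.map_top_of_surjective φ hφ, ← Subgroup.map_lowerCentralSeries,
        Subgroup.map_eq_bot_iff, QuotientGroup.ker_mk']
    have hcomm (i) : (φ (x i))⁻¹ * φ (y i) ∈ commutator (G ⧸ N) := by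
      rw [← map_inv, ← map_mul]
      have h := Subgroup.mem_map_of_mem φ (hxy i)
      rwa [commutator_def, Subgroup.map_commutator, Subgroup.map_top_of_surjective φ hφ] at h
    obtain ⟨z, hxz, hz⟩ := reflTransGen_move_lift φ hφ x
      (ih hQ _ _ (normalClosure_range_comp φ hφ x hx) hcomm)
    -- `N` is by definition the commutator of the preceding term with `G`, and it is central because
    -- the next term vanishes.
    refine hxz.trans (reflTransGen_move_of_central ((⊤ : Subgroup G).lowerCentralSeries n) ?_ z y
      ((normalClosure_eq_of_reflTransGen hxz).trans hx) fun i => ?_)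
    · intro c hc
      refine Subgroup.mem_center_iff.mpr fun g => ?_
      have h : ⁅c, g⁆ ∈ (⊤ : Subgroup G).lowerCentralSeries (n + 1 + 1) :=
        Subgroup.commutator_mem_commutator hc (Subgroup.mem_top g)
      rw [hn, Subgroup.mem_bot, commutatorElement_eq_one_iff_mul_comm] at h
      exact h.symm
    · exact QuotientGroup.eq.mp (congrFun hz i)

/-- The quotient by the normal closure of `s` is both perfect and nilpotent, hence trivial. -/
theorem normalClosure_eq_top_of_abelianization {G : Type*} [Group G] (hG : Group.IsNilpotent G)
    (s : Set G)
    (hs : Subgroup.normalClosure (QuotientGroup.mk' (commutator G) '' s) = ⊤) :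
    Subgroup.normalClosure s = ⊤ := by
  let N := Subgroup.normalClosure s
  let φ := QuotientGroup.mk' N
  have hφ : Surjective φ := QuotientGroup.mk'_surjective N
  have hsup : N ⊔ commutator G = ⊤ := by
    have h := Subgroup.map_normalClosure s (QuotientGroup.mk' (commutator G))
      (QuotientGroup.mk'_surjective _)
    rw [hs] at h
    have h' := congrArg (Subgroup.comap (QuotientGroup.mk' (commutator G))) h
    rwa [Subgroup.comap_map_eq, QuotientGroup.ker_mk', Subgroup.comap_top] at h'
  have hperf : commutator (G ⧸ N) = ⊤ := by
    have h := congrArg (Subgroup.map φ) hsup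
    rwa [Subgroup.map_sup, (Subgroup.map_eq_bot_iff N).mpr (QuotientGroup.ker_mk' N).ge,
      bot_sup_eq, commutator_def, Subgroup.map_commutator,
      Subgroup.map_top_of_surjective φ hφ] at h
  have hsub : Subsingleton (G ⧸ N) := by
    by_contra hne
    rw [not_subsingleton_iff_nontrivial] at hne
    exact (Group.IsSolvable.commutator_lt_top_of_nontrivial (G ⧸ N)).ne hperf
  exact QuotientGroup.subgroup_eq_top_of_subsingleton N hsub

/-! ### From sequences of moves to paths in the graph. -/

theorem reflTransGen_move_of_reachable {k : ℕ} {G : Type*} [Group G] {N : Subgroup G}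
    {x y : Vertex k G N} (h : (graph k G N).Reachable x y) : ReflTransGen Move x.1 y.1 := by
  rw [SimpleGraph.reachable_iff_reflTransGen] at h
  induction h with
  | refl => exact .refl
  | tail _ h ih =>
    exact ih.tail (((SimpleGraph.fromRel_adj _ _ _).mp h).2.elim id Move.symm)

theorem Move.reachable {k : ℕ} {G : Type*} [Group G] {N : Subgroup G} {x y : Vertex k G N}
    (h : Move x.1 y.1) : (graph k G N).Reachable x y := by
  by_cases hxy : x = y
  · rw [hxy]
  · exact SimpleGraph.Adj.reachable ((SimpleGraph.fromRel_adj _ _ _).mpr ⟨hxy, .inl h⟩)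

theorem induce_reachable_of_reflTransGen {k : ℕ} {G : Type*} [Group G] {N : Subgroup G}
    (P : Set (Vertex k G N)) (hP : ∀ u v : Vertex k G N, Move u.1 v.1 → u ∈ P → v ∈ P)
    (u : P) {b : Fin k → G} (h : ReflTransGen Move u.1.1 b) :
    ∃ v : P, v.1.1 = b ∧ ((graph k G N).induce P).Reachable u v := by
  induction h with
  | refl => exact ⟨u, rfl, .refl _⟩
  | @tail _ c _ h ih =>
    obtain ⟨v, rfl, huv⟩ := ih
    let w : Vertex k G N := ⟨c, h.normalClosure_eq.trans v.1.2⟩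
    -- A move may fix the tuple, in which case it gives no edge.
    refine ⟨⟨w, hP v.1 w h v.2⟩, rfl, huv.trans ?_⟩
    by_cases hvw : v.1 = w
    · exact (Subtype.ext hvw : v = ⟨w, hP v.1 w h v.2⟩) ▸ .refl v
    · refine SimpleGraph.Adj.reachable ?_
      have hadj : (graph k G N).Adj v.1 w := ⟨hvw, .inl h⟩
      exact hadj

end AndrewsCurtis

theorem mainTheorem3 (G : Type*) [Group G] [Finite G] (hG : Group.IsNilpotent G) (k : ℕ)
    (C : (AndrewsCurtis.graph k (G ⧸ commutator G) ⊤).ConnectedComponent) :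
    ((AndrewsCurtis.graph k G ⊤).induce
      (AndrewsCurtis.vertexMap k (QuotientGroup.mk' (commutator G))
        (QuotientGroup.mk'_surjective (commutator G)) ⁻¹' C.supp)).Connected := by
  open AndrewsCurtis in
  let φ := QuotientGroup.mk' (commutator G)
  have hφ : Function.Surjective φ := QuotientGroup.mk'_surjective (commutator G)
  rw [SimpleGraph.connected_iff]
  constructor
  · intro u v
    have hcomp := C.reachable_of_mem_supp u.2 v.2
    obtain ⟨y, huy, hy⟩ := reflTransGen_move_lift φ hφ u.1.1 (reflTransGen_move_of_reachable hcomp)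
    obtain ⟨n, hn⟩ := Subgroup.nilpotent_iff_lowerCentralSeries.mp hG
    have hyv := reflTransGen_move_of_mem_commutator n
      (le_bot_iff.mp (hn ▸ Subgroup.lowerCentralSeries_antitone ⊤ n.le_succ)) y v.1.1
      ((normalClosure_eq_of_reflTransGen huy).trans u.1.2)
      (fun i => QuotientGroup.eq.mp (congrFun hy i))
    -- Moves descend to the quotient, so the preimage of a component is closed under them.
    obtain ⟨w, hw, huw⟩ := induce_reachable_of_reflTransGen _ (fun a b hab ha => by
      have h : (graph k (G ⧸ commutator G) ⊤).Reachable (vertexMap k φ hφ a)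
        (vertexMap k φ hφ b) := Move.reachable (hab.map φ)
      exact (SimpleGraph.ConnectedComponent.sound h).symm.trans ha) u (huy.trans hyv)
    rwa [show v = w from Subtype.ext (Subtype.ext hw.symm)]
  · obtain ⟨c, hc⟩ := C.nonempty_supp
    choose x hx using fun i => hφ (c.1 i)
    have hxc : (fun i => φ (x i)) = c.1 := funext hx
    have htop : Subgroup.normalClosure (Set.range x) = ⊤ := by
      refine normalClosure_eq_top_of_abelianization hG _ ?_
      rw [← Set.range_comp]
      exact (congrArg (fun f => Subgroup.normalClosure (Set.range f)) hxc).trans c.2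
    refine ⟨⟨⟨x, htop⟩, ?_⟩⟩
    have : vertexMap k φ hφ ⟨x, htop⟩ = c := Subtype.ext hxc
    rwa [← this] at hc
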